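/- All Hilbert spaces are finite-dimensional and complex, $\log$ is to base $2$, and $\mathcal S_{\le}(\mathcal H)$ (resp. $\mathcal S_{=}(\mathcal H)$) is the set of positive semi-definite operators $\rho$ on $\mathcal H$ with $0<\operatorname{tr}\rho\le 1$ (resp. $\operatorname{tr}\rho=1$). For $\rho,\tau\in\mathcal S_{\le}(\mathcal H)$ let $F(\rho,\tau)=\|\sqrt\rho\sqrt\tau\|_1$, let $$\bar F(\rho,\tau)=\sup_{\bar{\mathcal H}\supseteq\mathcal H}\ \sup\{F(\bar\rho,\bar\tau):\ \bar\rho,\bar\tau\in\mathcal S_{=}(\bar{\mathcal H}),\ \Pi\bar\rho\,\Pi=\rho,\ \Pi\bar\tau\,\Pi=\tau\},$$ where $\Pi$ is the projector of $\bar{\mathcal H}$ onto $\mathcal H$, and let $P(\rho,\tau)=\sqrt{1-\bar F(\rho,\tau)^2}$ be the purified distance. For $\rho_{AB}\in\mathcal S_{\le}(\mathcal H_A\otimes\mathcal H_B)$ and $0\le\varepsilon<\sqrt{\operatorname{tr}\rho_{AB}}$ define $$H_{\min}(A|B)_\rho=\sup_{\sigma_B\in\mathcal S_{=}(\mathcal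 H_B)}\sup\{\lambda\in\mathbb R:\ 2^{-\lambda}\,\mathrm{id}_A\otimes\sigma_B\ge\rho_{AB}\},$$ $$H^{\varepsilon}_{\min}(A|B)_\rho=\sup\{H_{\min}(A|B)_{\tilde\rho}:\ \tilde\rho_{AB}\in\mathcal S_{\le}(\mathcal H_A\otimes\mathcal H_B),\ P(\tilde\rho_{AB},\rho_{AB})\le\varepsilon\},$$ $$H^{\varepsilon}_{\max}(A|B)_\rho=-H^{\varepsilon}_{\min}(A|C)_\rho,$$ where $\rho_{ABC}$ is any purification of $\rho_{AB}$; the value does not depend on the choice of the purification. **Theorem 1 (data-processing inequalities).** Let $\rho_{AB}\in\mathcal S_{\le}(\mathcal H_A\otimes\mathcal H_B)$, let $0\le\varepsilon<\sqrt{\operatorname{tr}\rho_{AB}}$, let $\mathcal E$ be a trace preserving completely positive map from operators on $\mathcal H_B$ to operators on $\mathcal H_D$, and let $\tau_{AD}=(\mathrm{id}_A\otimes\mathcal E)(\rho_{AB})$. Then $$H^{\varepsilon}_{\min}(A|B)_\rho\le H^{\varepsilon}_{\min}(A|D)_\tau\qquad\text{and}\qquad H^{\varepsilon}_{\max}(A|B)_\rho\le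 H^{\varepsilon}_{\max}(A|D)_\tau ,$$ where the max-entropies may be computed from arbitrary purifications of $\rho_{AB}$ and of $\tau_{AD}$. -/

import Mathlib

open scoped ComplexOrder MatrixOrder Kronecker

/- Finite-dimensional Hilbert spaces are represented in an orthonormal basis: a space with basis
indexed by the finite type `I` is `ℂ^I`, an operator on it is a matrix `Matrix I I ℂ`, and the
tensor product of the spaces of `I` and `J` is the space of `I × J`.  The order on matrices is the
Loewner order: `X ≤ Y` means that `Y - X` is positive semi-definite. -/

namespace QInfo

/-- Normalized quantum states: positive semi-definite operators of trace one. -/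
def IsNormalizedState {I : Type*} [Fintype I] (ρ : Matrix I I ℂ) : Prop :=
  ρ.PosSemidef ∧ ρ.trace = 1

/-- Sub-normalized quantum states: positive semi-definite operators with `0 < tr ρ ≤ 1`. -/
def IsSubnormalizedState {I : Type*} [Fintype I] (ρ : Matrix I I ℂ) : Prop :=
  ρ.PosSemidef ∧ 0 < ρ.trace.re ∧ ρ.trace.re ≤ 1

/-- Trace norm `‖X‖₁ = tr |X| = tr √(X† X)`. -/
noncomputable def traceNorm {I : Type*} [Fintype I] [DecidableEq I] (X : Matrix I I ℂ) : ℝ :=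
  (CFC.sqrt (star X * X)).trace.re

/-- Fidelity `F(ρ, τ) = ‖√ρ √τ‖₁`. -/
noncomputable def fidelity {I : Type*} [Fintype I] [DecidableEq I] (ρ τ : Matrix I I ℂ) : ℝ :=
  traceNorm (CFC.sqrt ρ * CFC.sqrt τ)

/-- Generalized fidelity: the supremum of `F(ρ', τ')` over all finite-dimensional Hilbert spaces
`ℂ^I ⊕ ℂ^n` in which `ℂ^I` is embedded and all normalized states `ρ'`, `τ'` on them whose
compressions to `ℂ^I` are `ρ` and `τ`. -/
noncomputable def genFidelity {I : Type*} [Fintype I] [DecidableEq I] (ρ τ : Matrix I I ℂ) : ℝ :=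
  sSup {x : ℝ | ∃ (n : ℕ) (ρ' τ' : Matrix (I ⊕ Fin n) (I ⊕ Fin n) ℂ),
    IsNormalizedState ρ' ∧ IsNormalizedState τ' ∧
    ρ'.toBlocks₁₁ = ρ ∧ τ'.toBlocks₁₁ = τ ∧ x = fidelity ρ' τ'}

/-- Purified distance. -/
noncomputable def purifiedDistance {I : Type*} [Fintype I] [DecidableEq I]
    (ρ τ : Matrix I I ℂ) : ℝ :=
  Real.sqrt (1 - genFidelity ρ τ ^ 2)

/-- The `ε`-ball of sub-normalized states around `ρ` in purified distance. -/
def epsBall {I : Type*} [Fintype I] [DecidableEq I] (ε : ℝ) (ρ : Matrix I I ℂ) :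
    Set (Matrix I I ℂ) :=
  {τ | IsSubnormalizedState τ ∧ purifiedDistance τ ρ ≤ ε}

/-- Min-entropy `H_min(A|B)_ρ`, with values in the extended reals (so that the supremum over the
empty set of admissible `r` is `-∞`). -/
noncomputable def minEntropy {A B : Type*} [Fintype A] [DecidableEq A] [Fintype B]
    (ρ : Matrix (A × B) (A × B) ℂ) : EReal :=
  ⨆ (σ : Matrix B B ℂ) (_ : IsNormalizedState σ),
    sSup ((fun r : ℝ => (r : EReal)) ''
      {r : ℝ | ρ ≤ ((2 : ℝ) ^ (-r)) • ((1 : Matrix A A ℂ) ⊗ₖ σ)})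

/-- Smooth min-entropy `H_min^ε(A|B)_ρ`. -/
noncomputable def smoothMinEntropy {A B : Type*} [Fintype A] [DecidableEq A] [Fintype B]
    [DecidableEq B] (ε : ℝ) (ρ : Matrix (A × B) (A × B) ℂ) : EReal :=
  ⨆ (ρ' : Matrix (A × B) (A × B) ℂ) (_ : ρ' ∈ epsBall ε ρ), minEntropy ρ'

/-- Partial trace over the second tensor factor. -/
def traceOutRight {I J : Type*} [Fintype J] (X : Matrix (I × J) (I × J) ℂ) : Matrix I I ℂ :=
  Matrix.of fun i i' => ∑ j, X (i, j) (i', j)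

/-- Partial trace over the middle factor of a tripartite system: `X_ABC ↦ X_AC`. -/
def traceOutMiddle {A B C : Type*} [Fintype B]
    (X : Matrix ((A × B) × C) ((A × B) × C) ℂ) : Matrix (A × C) (A × C) ℂ :=
  Matrix.of fun p q => ∑ b, X ((p.1, b), p.2) ((q.1, b), q.2)

/-- `Φ = |ψ⟩⟨ψ|` for some vector `ψ`. -/
def IsPure {I : Type*} (Φ : Matrix I I ℂ) : Prop :=
  ∃ ψ : I → ℂ, Φ = Matrix.vecMulVec ψ (star ψ)

/-- `Φ`, on the space of `I × C`, is a purification of `ρ` with purifying system `C`. -/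
def IsPurification {I C : Type*} [Fintype C] (Φ : Matrix (I × C) (I × C) ℂ)
    (ρ : Matrix I I ℂ) : Prop :=
  IsPure Φ ∧ traceOutRight Φ = ρ

/-- The canonical purification `∑ j, √ρ |j⟩ ⊗ |j⟩` of `ρ`, as a rank-one operator; the purifying
system is a copy of the space of `ρ`. -/
noncomputable def canonicalPurification {I : Type*} [Fintype I] [DecidableEq I]
    (ρ : Matrix I I ℂ) : Matrix (I × I) (I × I) ℂ :=
  Matrix.vecMulVec (fun p => CFC.sqrt ρ p.1 p.2) (star fun p => CFC.sqrt ρ p.1 p.2)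

theorem isPurification_canonicalPurification {I : Type*} [Fintype I] [DecidableEq I]
    {ρ : Matrix I I ℂ} (hρ : ρ.PosSemidef) : IsPurification (canonicalPurification ρ) ρ := by
  refine ⟨⟨_, rfl⟩, ?_⟩
  have h1 : CFC.sqrt ρ * CFC.sqrt ρ = ρ := CFC.sqrt_mul_sqrt_self ρ hρ.nonneg
  have h2 : star (CFC.sqrt ρ) = CFC.sqrt ρ := (CFC.sqrt_nonneg ρ).isSelfAdjoint
  have h3 : CFC.sqrt ρ * star (CFC.sqrt ρ) = ρ := by rw [h2, h1]
  ext i j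
  conv_rhs => rw [← h3]
  simp [traceOutRight, canonicalPurification, Matrix.vecMulVec_apply, Matrix.mul_apply,
    Matrix.star_apply]

/-- Smooth max-entropy `H_max^ε(A|B)_ρ = -H_min^ε(A|C)` of a purification `ρ_ABC` of `ρ_AB`; here
the canonical one is used. -/
noncomputable def smoothMaxEntropy {A B : Type*} [Fintype A] [DecidableEq A] [Fintype B]
    [DecidableEq B] (ε : ℝ) (ρ : Matrix (A × B) (A × B) ℂ) : EReal :=
  -smoothMinEntropy ε (traceOutMiddle (canonicalPurification ρ))

/-- `(id ⊗ E)(X)` for a linear map `E` on operators. -/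
def idTensor {R B D : Type*} (E : Matrix B B ℂ →ₗ[ℂ] Matrix D D ℂ)
    (X : Matrix (R × B) (R × B) ℂ) : Matrix (R × D) (R × D) ℂ :=
  Matrix.of fun p q => E (Matrix.of fun b b' => X (p.1, b) (q.1, b')) p.2 q.2

/-- Trace preserving completely positive maps (TP-CPMs). -/
def IsTPCPM {B D : Type*} [Fintype B] [Fintype D]
    (E : Matrix B B ℂ →ₗ[ℂ] Matrix D D ℂ) : Prop :=
  (∀ (n : ℕ) (X : Matrix (Fin n × B) (Fin n × B) ℂ),
    X.PosSemidef → (idTensor E X).PosSemidef) ∧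
  ∀ X : Matrix B B ℂ, (E X).trace = X.trace

end QInfo

/-!
All four claims follow from data processing for the smooth min-entropy,
`H_min^ε(A|B)_ρ ≤ H_min^ε(A|D)_{(id ⊗ E)(ρ)}` (`QInfo.IsTPCPM.smoothMinEntropy_le`), applied to
various TP-CPMs `E`.

For that inequality, `id ⊗ E` preserves positivity, so it turns `ρ' ≤ 2^{-r} id ⊗ σ` into
`(id ⊗ E)(ρ') ≤ 2^{-r} id ⊗ E(σ)`; what remains is that it does not increase the purified distance.
The fidelity is the value of a semidefinite program,
`F(ρ, τ) = max {Re tr X : [[τ, X], [X†, ρ]] ≥ 0}`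
(`QInfo.exists_fromBlocks_trace_eq_fidelity` and `QInfo.re_trace_le_fidelity`), and a trace
preserving 2-positive map sends feasible points to feasible points with the same value. The
generalized fidelity reduces to this by extending `F` to `ℂ^I ⊕ ℂ^N` as `F` on the first block, the
identity on the second, and zero off the diagonal (`QInfo.directSumMap`); no closed formula for it
is needed. Both halves of the semidefinite program rest on
`QInfo.exists_contraction_mul`: matrices with the same Gram matrix differ by a contraction.

The same lemma shows that two purifications of a state are related by a contraction on the
purifying system, which is completed to a TP-CPM; data processing in both directions gives the
independence of `H_max^ε` from the purification (`QInfo.smoothMinEntropy_traceOutMiddle_le`).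

For the max-entropy, let `V k` be Kraus operators of `E` and let `ψ` on `ABC` purify `ρ`. Then
`∑ k, V k ψ ⊗ |k⟩` purifies `(id ⊗ E)(ρ)` with purifying system `KC`, and tracing out `K` from its
`AKC` marginal gives the `AC` marginal of `ψ`. Data processing for this partial trace is
the claim (`QInfo.IsTPCPM.smoothMaxEntropy_le`).
-/

namespace QInfo

open Matrix

/-! ### Contractions and factorizations -/

/-- A Hermitian matrix has a Hermitian generalized inverse, obtained by inverting the nonzero
eigenvalues. -/
theorem exists_generalizedInverse {n : Type*} [Fintype n] [DecidableEq n] {S : Matrix n n ℂ}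
    (hS : S.IsHermitian) :
    ∃ R : Matrix n n ℂ, R.IsHermitian ∧ S * R * S = S ∧ R * S * R = R := by
  have hS' : IsSelfAdjoint S := hS
  have hc (f : ℝ → ℝ) : ContinuousOn f (spectrum ℝ S) :=
    (Matrix.finite_real_spectrum).continuousOn f
  have hid : cfc (fun x : ℝ => x) S = S := cfc_id' ℝ S
  refine ⟨cfc (fun x : ℝ => x⁻¹) S, cfc_predicate (R := ℝ) _ S, ?_, ?_⟩
  · calc S * cfc (fun x : ℝ => x⁻¹) S * S
        = cfc (fun x : ℝ => x) S * cfc (fun x : ℝ => x⁻¹) S * cfc (fun x : ℝ => x) S := by rw [hid]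
      _ = cfc (fun x : ℝ => x * x⁻¹ * x) S := by
        rw [← cfc_mul _ _ _ (hc _) (hc _), ← cfc_mul _ _ _ (hc _) (hc _)]
      _ = S := by simp only [mul_inv_mul_cancel, hid]
  · calc cfc (fun x : ℝ => x⁻¹) S * S * cfc (fun x : ℝ => x⁻¹) S
        = cfc (fun x : ℝ => x⁻¹) S * cfc (fun x : ℝ => x) S * cfc (fun x : ℝ => x⁻¹) S := by
          rw [hid]
      _ = cfc (fun x : ℝ => x⁻¹ * x * x⁻¹) S := by
        rw [← cfc_mul _ _ _ (hc _) (hc _), ← cfc_mul _ _ _ (hc _) (hc _)]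
      _ = cfc (fun x : ℝ => x⁻¹) S := by
        congr 1
        ext x
        simpa using mul_inv_mul_cancel x⁻¹

/-- `K` is a contraction, i.e. `K† K ≤ 1`. -/
def IsContraction {m n : Type*} [Fintype m] [DecidableEq n] (K : Matrix m n ℂ) : Prop :=
  (1 - Kᴴ * K).PosSemidef

theorem IsContraction.mul {l m n : Type*} [Fintype l] [Fintype m] [Finite n] [DecidableEq m]
    [DecidableEq n] {K : Matrix l m ℂ} {L : Matrix m n ℂ} (hK : IsContraction K)
    (hL : IsContraction L) : IsContraction (K * L) := by
  have h := hL.add (hK.conjTranspose_mul_mul_same L)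
  unfold IsContraction
  convert h using 1
  simp only [conjTranspose_mul, Matrix.mul_sub, Matrix.sub_mul, Matrix.mul_one, Matrix.mul_assoc]
  abel

theorem isContraction_iff_fromBlocks {m n : Type*} [Fintype m] [DecidableEq m] [Finite n]
    [DecidableEq n] {K : Matrix m n ℂ} :
    IsContraction K ↔ (fromBlocks 1 K Kᴴ 1).PosSemidef := by
  let _ : Invertible (1 : Matrix m m ℂ) := invertibleOne
  rw [PosDef.fromBlocks₁₁ K 1 PosDef.one]
  simp [IsContraction]

theorem IsContraction.conjTranspose {m n : Type*} [Fintype m] [DecidableEq m] [Fintype n]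
    [DecidableEq n] {K : Matrix m n ℂ} (hK : IsContraction K) : IsContraction Kᴴ := by
  have h := isContraction_iff_fromBlocks.1 hK
  let _ : Invertible (1 : Matrix n n ℂ) := invertibleOne
  rw [PosDef.fromBlocks₂₂ 1 K PosDef.one] at h
  simpa [IsContraction] using h

/-- Two matrices with the same Gram matrix differ by a contraction on the left (which may be taken
to be a partial isometry). -/
theorem exists_contraction_mul {m p n : Type*} [Fintype m] [DecidableEq m] [Fintype p]
    [Fintype n] [DecidableEq n] (M : Matrix m n ℂ) (N : Matrix p n ℂ) (h : Mᴴ * M = Nᴴ * N) :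
    ∃ K : Matrix p m ℂ, IsContraction K ∧ N = K * M := by
  obtain ⟨R, hR, hSRS, hRSR⟩ := exists_generalizedInverse (isHermitian_conjTranspose_mul_self M)
  have hR' : Rᴴ = R := hR
  have hQ : (N * R * Mᴴ)ᴴ * (N * R * Mᴴ) = M * R * Mᴴ := by
    calc (N * R * Mᴴ)ᴴ * (N * R * Mᴴ) = M * (R * (Nᴴ * N) * R) * Mᴴ := by
          simp only [conjTranspose_mul, conjTranspose_conjTranspose, hR', Matrix.mul_assoc]
      _ = M * R * Mᴴ := by rw [← h, hRSR]
  refine ⟨N * R * Mᴴ, ?_, ?_⟩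
  · -- `M R M†` is an orthogonal projection, hence so is `1 - M R M†`
    have hidem : (M * R * Mᴴ) * (M * R * Mᴴ) = M * R * Mᴴ := by
      calc (M * R * Mᴴ) * (M * R * Mᴴ) = M * (R * (Mᴴ * M) * R) * Mᴴ := by
            simp only [Matrix.mul_assoc]
        _ = M * R * Mᴴ := by rw [hRSR]
    have hherm : (M * R * Mᴴ)ᴴ = M * R * Mᴴ := by
      simp only [conjTranspose_mul, conjTranspose_conjTranspose, hR', Matrix.mul_assoc]
    have h1 := posSemidef_conjTranspose_mul_self (1 - M * R * Mᴴ)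
    rw [conjTranspose_sub, conjTranspose_one, hherm] at h1
    unfold IsContraction
    rw [hQ]
    convert h1 using 1
    rw [Matrix.mul_sub, Matrix.sub_mul, Matrix.sub_mul, hidem]
    simp
  · have hz : (N - N * (R * (Mᴴ * M)))ᴴ * (N - N * (R * (Mᴴ * M))) = 0 := by
      have e1 : (N - N * (R * (Mᴴ * M)))ᴴ = Nᴴ - Mᴴ * M * R * Nᴴ := by
        simp only [conjTranspose_sub, conjTranspose_mul, conjTranspose_conjTranspose, hR',
          Matrix.mul_assoc]
      have e2 : (Nᴴ - Mᴴ * M * R * Nᴴ) * (N - N * (R * (Mᴴ * M)))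
          = Nᴴ * N - Nᴴ * N * R * (Mᴴ * M) - (Mᴴ * M) * R * (Nᴴ * N)
            + (Mᴴ * M) * R * (Nᴴ * N) * R * (Mᴴ * M) := by
        simp only [Matrix.mul_sub, Matrix.sub_mul, Matrix.mul_assoc]
        abel
      rw [e1, e2, ← h, hSRS, hSRS]
      abel
    exact (sub_eq_zero.1 (conjTranspose_mul_self_eq_zero.1 hz)).trans
      (by simp only [Matrix.mul_assoc])

theorem _root_.Matrix.PosSemidef.exists_eq_conjTranspose_mul_self {n : Type*} [Fintype n]
    [DecidableEq n] {P : Matrix n n ℂ} (hP : P.PosSemidef) :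
    ∃ G : Matrix n n ℂ, P = Gᴴ * G := by
  refine ⟨CFC.sqrt P, ?_⟩
  have h2 : (CFC.sqrt P)ᴴ = CFC.sqrt P := (CFC.sqrt_nonneg P).isSelfAdjoint
  rw [h2, CFC.sqrt_mul_sqrt_self P hP.nonneg]

/-! ### Fidelity -/

section Fidelity

variable {I : Type*} [Fintype I] [DecidableEq I]

theorem conjTranspose_sqrt (P : Matrix I I ℂ) : (CFC.sqrt P)ᴴ = CFC.sqrt P :=
  (CFC.sqrt_nonneg P).isSelfAdjoint

theorem re_trace_contraction_mul_le {L P : Matrix I I ℂ} (hL : IsContraction L)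
    (hP : P.PosSemidef) : (L * P).trace.re ≤ P.trace.re := by
  obtain ⟨G, rfl⟩ := hP.exists_eq_conjTranspose_mul_self
  -- `2 - L - L† = (1 - L)† (1 - L) + (1 - L† L)` is positive
  have h := (((posSemidef_conjTranspose_mul_self (1 - L)).add hL).mul_mul_conjTranspose_same
    G).trace_nonneg
  have e : G * ((1 - L)ᴴ * (1 - L) + (1 - Lᴴ * L)) * Gᴴ
      = G * Gᴴ + G * Gᴴ - G * L * Gᴴ - (G * L * Gᴴ)ᴴ := by
    simp only [conjTranspose_sub, conjTranspose_one, conjTranspose_mul,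
      conjTranspose_conjTranspose, Matrix.mul_sub, Matrix.sub_mul, Matrix.mul_add, Matrix.add_mul,
      Matrix.mul_one, Matrix.one_mul, Matrix.mul_assoc]
    abel
  have t1 : (G * L * Gᴴ).trace = (L * (Gᴴ * G)).trace := by
    rw [Matrix.mul_assoc, Matrix.trace_mul_comm, Matrix.mul_assoc]
  rw [e, trace_sub, trace_sub, trace_add, trace_conjTranspose, t1, trace_mul_comm G] at h
  have := (Complex.le_def.1 h).1
  simp only [Complex.zero_re, Complex.sub_re, Complex.add_re, Complex.star_def,
    Complex.conj_re] at this
  linarith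

theorem traceNorm_nonneg (X : Matrix I I ℂ) : 0 ≤ traceNorm X :=
  (Complex.le_def.1 (Matrix.nonneg_iff_posSemidef.1
    (CFC.sqrt_nonneg (star X * X))).trace_nonneg).1

theorem sqrt_star_mul_self_mul_self (A : Matrix I I ℂ) :
    (CFC.sqrt (star A * A))ᴴ * CFC.sqrt (star A * A) = Aᴴ * A := by
  rw [conjTranspose_sqrt, CFC.sqrt_mul_sqrt_self _ (star_mul_self_nonneg A)]
  rfl

/-- Half of the duality between the trace norm and the operator norm, by polar decomposition. -/
theorem re_trace_contraction_mul_le_traceNorm {K : Matrix I I ℂ} (A : Matrix I I ℂ)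
    (hK : IsContraction K) : (K * A).trace.re ≤ traceNorm A := by
  obtain ⟨U, hU, hA⟩ := exists_contraction_mul _ A (sqrt_star_mul_self_mul_self A)
  have h := re_trace_contraction_mul_le (hK.mul hU)
    (Matrix.nonneg_iff_posSemidef.1 (CFC.sqrt_nonneg (star A * A)))
  rwa [Matrix.mul_assoc, ← hA] at h

/-- The semidefinite program for the fidelity: the optimal value is attained. -/
theorem exists_fromBlocks_trace_eq_fidelity {ρ τ : Matrix I I ℂ} (hρ : ρ.PosSemidef)
    (hτ : τ.PosSemidef) :
    ∃ X : Matrix I I ℂ, (fromBlocks τ X Xᴴ ρ).PosSemidef ∧ X.trace.re = fidelity ρ τ := by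
  obtain ⟨K, hK, hA⟩ := exists_contraction_mul _ _
    (sqrt_star_mul_self_mul_self (CFC.sqrt ρ * CFC.sqrt τ)).symm
  refine ⟨CFC.sqrt τ * K * CFC.sqrt ρ, ?_, ?_⟩
  · have h := (isContraction_iff_fromBlocks.1 hK).mul_mul_conjTranspose_same
      (fromBlocks (CFC.sqrt τ) 0 0 (CFC.sqrt ρ))
    convert h using 1
    simp [fromBlocks_conjTranspose, fromBlocks_multiply, conjTranspose_sqrt,
      CFC.sqrt_mul_sqrt_self _ hρ.nonneg, CFC.sqrt_mul_sqrt_self _ hτ.nonneg, Matrix.mul_assoc]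
  · unfold fidelity traceNorm
    rw [hA, Matrix.mul_assoc, Matrix.trace_mul_comm, Matrix.mul_assoc]

/-- The semidefinite program for the fidelity: every feasible value is a lower bound. -/
theorem re_trace_le_fidelity {ρ τ X Y : Matrix I I ℂ} (h : (fromBlocks τ X Y ρ).PosSemidef) :
    X.trace.re ≤ fidelity ρ τ := by
  have hτ : τ.PosSemidef := h.submatrix Sum.inl
  have hρ : ρ.PosSemidef := h.submatrix Sum.inr
  obtain ⟨G, hG⟩ := h.exists_eq_conjTranspose_mul_self
  set G₁ : Matrix (I ⊕ I) I ℂ := G.submatrix id Sum.inl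
  set G₂ : Matrix (I ⊕ I) I ℂ := G.submatrix id Sum.inr
  have h₁ : τ = G₁ᴴ * G₁ := congrArg toBlocks₁₁ hG
  have h₂ : ρ = G₂ᴴ * G₂ := congrArg toBlocks₂₂ hG
  have h₃ : X = G₁ᴴ * G₂ := congrArg toBlocks₁₂ hG
  obtain ⟨U₁, hU₁, e₁⟩ := exists_contraction_mul (CFC.sqrt τ) G₁
    (by rw [conjTranspose_sqrt, CFC.sqrt_mul_sqrt_self _ hτ.nonneg, ← h₁])
  obtain ⟨U₂, hU₂, e₂⟩ := exists_contraction_mul (CFC.sqrt ρ) G₂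
    (by rw [conjTranspose_sqrt, CFC.sqrt_mul_sqrt_self _ hρ.nonneg, ← h₂])
  have h := re_trace_contraction_mul_le_traceNorm (CFC.sqrt ρ * CFC.sqrt τ)
    (hU₁.conjTranspose.mul hU₂)
  rw [h₃, e₁, e₂, conjTranspose_mul, conjTranspose_sqrt, Matrix.mul_assoc, Matrix.trace_mul_comm]
  simpa only [fidelity, Matrix.mul_assoc] using h

theorem fidelity_le_one {ρ τ : Matrix I I ℂ} (hρ : IsNormalizedState ρ)
    (hτ : IsNormalizedState τ) : fidelity ρ τ ≤ 1 := by
  obtain ⟨X, hX, hF⟩ := exists_fromBlocks_trace_eq_fidelity hρ.1 hτ.1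
  have h := (hX.conjTranspose_mul_mul_same (fromRows (1 : Matrix I I ℂ) (-1))).trace_nonneg
  rw [conjTranspose_fromRows_eq_fromCols_conjTranspose, fromCols_mul_fromBlocks,
    fromCols_mul_fromRows] at h
  simp only [conjTranspose_one, conjTranspose_neg, Matrix.one_mul, Matrix.neg_mul, Matrix.mul_one,
    Matrix.mul_neg, trace_add, trace_neg, trace_conjTranspose, hρ.2, hτ.2] at h
  have := (Complex.le_def.1 h).1
  simp at this
  linarith

end Fidelity

/-! ### Monotonicity of the generalized fidelity -/

/-- `F` is 2-positive: it preserves positivity of `2 × 2` block operators. -/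
def IsTwoPositive {I J : Type*} (F : Matrix I I ℂ → Matrix J J ℂ) : Prop :=
  ∀ P X Y Q, (fromBlocks P X Y Q).PosSemidef → (fromBlocks (F P) (F X) (F Y) (F Q)).PosSemidef

theorem IsTwoPositive.posSemidef {I J : Type*} {F : Matrix I I ℂ → Matrix J J ℂ}
    (hF : IsTwoPositive F) {P : Matrix I I ℂ} (hP : P.PosSemidef) : (F P).PosSemidef := by
  have h : (fromBlocks P P P P).PosSemidef := by
    convert hP.submatrix (Sum.elim id id) using 1
    ext (i | i) (j | j) <;> rfl
  exact (hF P P P P h).submatrix Sum.inl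

/-- The extension of `F` to `ℂ^I ⊕ ℂ^N` that discards the off-diagonal blocks and acts as the
identity on the second summand. -/
def directSumMap {I J N : Type*} (F : Matrix I I ℂ → Matrix J J ℂ)
    (Z : Matrix (I ⊕ N) (I ⊕ N) ℂ) : Matrix (J ⊕ N) (J ⊕ N) ℂ :=
  fromBlocks (F Z.toBlocks₁₁) 0 0 Z.toBlocks₂₂

section TwoPositive

variable {I J : Type*} [Fintype I] [Fintype J]

theorem IsTwoPositive.fidelity_le [DecidableEq I] [DecidableEq J]
    {F : Matrix I I ℂ → Matrix J J ℂ} (hF : IsTwoPositive F)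
    (htr : ∀ X, (F X).trace = X.trace) {ρ τ : Matrix I I ℂ} (hρ : ρ.PosSemidef)
    (hτ : τ.PosSemidef) : fidelity ρ τ ≤ fidelity (F ρ) (F τ) := by
  obtain ⟨X, hX, h⟩ := exists_fromBlocks_trace_eq_fidelity hρ hτ
  rw [← h, ← htr X]
  exact re_trace_le_fidelity (hF _ _ _ _ hX)

theorem posSemidef_fromBlocks_diagonal {P : Matrix I I ℂ} {Q : Matrix J J ℂ}
    (hP : P.PosSemidef) (hQ : Q.PosSemidef) : (fromBlocks P 0 0 Q).PosSemidef := by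
  classical
  obtain ⟨G, rfl⟩ := hP.exists_eq_conjTranspose_mul_self
  obtain ⟨H, rfl⟩ := hQ.exists_eq_conjTranspose_mul_self
  have h := posSemidef_conjTranspose_mul_self (fromBlocks G 0 0 H)
  simpa [fromBlocks_conjTranspose, fromBlocks_multiply] using h

theorem genFidelity_nonneg [DecidableEq I] (ρ τ : Matrix I I ℂ) : 0 ≤ genFidelity ρ τ := by
  refine Real.sSup_nonneg ?_
  rintro y ⟨m, ρ'', τ'', -, -, -, -, rfl⟩
  exact traceNorm_nonneg _

theorem IsTwoPositive.directSumMap {I N : Type*} [Fintype N] {F : Matrix I I ℂ → Matrix J J ℂ}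
    (hF : IsTwoPositive F) :
    IsTwoPositive (directSumMap F : Matrix (I ⊕ N) (I ⊕ N) ℂ → Matrix (J ⊕ N) (J ⊕ N) ℂ) := by
  intro P X Y Q h
  have h₁ : (fromBlocks P.toBlocks₁₁ X.toBlocks₁₁ Y.toBlocks₁₁ Q.toBlocks₁₁).PosSemidef := by
    convert h.submatrix (Sum.map Sum.inl Sum.inl) using 1
    ext (i | i) (j | j) <;> rfl
  have h₂ : (fromBlocks P.toBlocks₂₂ X.toBlocks₂₂ Y.toBlocks₂₂ Q.toBlocks₂₂).PosSemidef := by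
    convert h.submatrix (Sum.map Sum.inr Sum.inr) using 1
    ext (i | i) (j | j) <;> rfl
  convert (posSemidef_fromBlocks_diagonal (hF _ _ _ _ h₁) h₂).submatrix
    (Equiv.sumSumSumComm J N J N) using 1
  ext ((i | i) | (i | i)) ((j | j) | (j | j)) <;> rfl

theorem trace_directSumMap {N : Type*} [Fintype N] {F : Matrix I I ℂ → Matrix J J ℂ}
    (htr : ∀ X, (F X).trace = X.trace) (Z : Matrix (I ⊕ N) (I ⊕ N) ℂ) :
    (directSumMap F Z).trace = Z.trace := by
  have h := htr Z.toBlocks₁₁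
  simp only [trace, diag_apply] at h
  simp only [trace, diag_apply, directSumMap, Fintype.sum_sum_type, fromBlocks_apply₁₁,
    fromBlocks_apply₂₂, h]
  rfl

/-- The generalized fidelity does not decrease under trace preserving 2-positive maps: `F` acts on
extensions through `directSumMap F`, which does not decrease their fidelity. -/
theorem IsTwoPositive.genFidelity_le [DecidableEq I] [DecidableEq J]
    {F : Matrix I I ℂ → Matrix J J ℂ} (hF : IsTwoPositive F)
    (htr : ∀ X, (F X).trace = X.trace) (ρ τ : Matrix I I ℂ) :
    genFidelity ρ τ ≤ genFidelity (F ρ) (F τ) := by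
  refine Real.sSup_le ?_ (genFidelity_nonneg _ _)
  rintro x ⟨n, ρ', τ', hρ', hτ', rfl, rfl, rfl⟩
  have hF' := hF.directSumMap (N := Fin n)
  have htr' := trace_directSumMap (N := Fin n) htr
  refine (hF'.fidelity_le htr' hρ'.1 hτ'.1).trans (le_csSup ⟨1, ?_⟩ ?_)
  · rintro y ⟨m, ρ'', τ'', hρ'', hτ'', -, -, rfl⟩
    exact fidelity_le_one hρ'' hτ''
  · exact ⟨n, _, _, ⟨hF'.posSemidef hρ'.1, (htr' _).trans hρ'.2⟩,
      ⟨hF'.posSemidef hτ'.1, (htr' _).trans hτ'.2⟩, rfl, rfl, rfl⟩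

theorem IsTwoPositive.purifiedDistance_le [DecidableEq I] [DecidableEq J]
    {F : Matrix I I ℂ → Matrix J J ℂ} (hF : IsTwoPositive F)
    (htr : ∀ X, (F X).trace = X.trace) (ρ τ : Matrix I I ℂ) :
    purifiedDistance (F ρ) (F τ) ≤ purifiedDistance ρ τ := by
  have h := pow_le_pow_left₀ (genFidelity_nonneg ρ τ) (hF.genFidelity_le htr ρ τ) 2
  exact Real.sqrt_le_sqrt (by linarith)

end TwoPositive

/-! ### Data processing for the smooth min-entropy -/

section IdTensor

variable {R A B D : Type*} (E : Matrix B B ℂ →ₗ[ℂ] Matrix D D ℂ)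

theorem idTensor_sub (X Y : Matrix (R × B) (R × B) ℂ) :
    idTensor E (X - Y) = idTensor E X - idTensor E Y := by
  ext p q
  exact congrFun₂ (map_sub E (of fun b b' => X (p.1, b) (q.1, b'))
    (of fun b b' => Y (p.1, b) (q.1, b'))) p.2 q.2

theorem idTensor_smul_one_kronecker [DecidableEq R] (c : ℝ) (σ : Matrix B B ℂ) :
    idTensor E (c • ((1 : Matrix R R ℂ) ⊗ₖ σ)) = c • ((1 : Matrix R R ℂ) ⊗ₖ E σ) := by
  ext p q
  have h : (of fun b b' => (c • ((1 : Matrix R R ℂ) ⊗ₖ σ)) (p.1, b) (q.1, b'))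
      = ((c : ℂ) * (1 : Matrix R R ℂ) p.1 q.1) • σ := by
    ext b b'
    simp [kroneckerMap_apply, mul_assoc]
  rw [idTensor, of_apply, h, map_smul]
  simp [kroneckerMap_apply, mul_assoc]

variable {E} [Fintype B] [Fintype D]

theorem trace_idTensor [Fintype R] (hE : ∀ X, (E X).trace = X.trace)
    (X : Matrix (R × B) (R × B) ℂ) : (idTensor E X).trace = X.trace := by
  simp only [trace, diag_apply, Fintype.sum_prod_type]
  exact Finset.sum_congr rfl fun a _ => hE (of fun b b' => X (a, b) (a, b'))

theorem IsTPCPM.posSemidef_idTensor [Finite R] (hE : IsTPCPM E) {X : Matrix (R × B) (R × B) ℂ}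
    (hX : X.PosSemidef) : (idTensor E X).PosSemidef := by
  obtain ⟨n, ⟨e⟩⟩ := Finite.exists_equiv_fin R
  convert (hE.1 n _ (hX.submatrix (Prod.map e.symm id))).submatrix (Prod.map e id) using 1
  ext p q
  simp [idTensor]

theorem IsTPCPM.isTwoPositive_idTensor [Finite R] (hE : IsTPCPM E) :
    IsTwoPositive (idTensor E : Matrix (R × B) (R × B) ℂ → _) := by
  intro P X Y Q h
  convert (hE.posSemidef_idTensor (h.submatrix (Equiv.sumProdDistrib R R B))).submatrix
    (Equiv.sumProdDistrib R R D).symm using 1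
  ext (i | i) (j | j) <;> rfl

theorem IsTPCPM.minEntropy_le [Fintype A] [DecidableEq A] (hE : IsTPCPM E)
    (ρ : Matrix (A × B) (A × B) ℂ) : minEntropy ρ ≤ minEntropy (idTensor E ρ) := by
  refine iSup₂_le fun σ hσ => ?_
  have hEσ : IsNormalizedState (E σ) := by
    refine ⟨?_, (hE.2 σ).trans hσ.2⟩
    exact (hE.posSemidef_idTensor (R := Unit) (hσ.1.submatrix Prod.snd)).submatrix
      (Prod.mk ())
  refine le_trans (sSup_le_sSup (Set.image_mono ?_)) (le_iSup₂_of_le (E σ) hEσ le_rfl)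
  intro r hr
  have h := hE.posSemidef_idTensor (Matrix.le_iff.1 hr)
  rw [idTensor_sub, idTensor_smul_one_kronecker] at h
  exact Matrix.le_iff.2 h

/-- Data processing: `id ⊗ E` maps the `ε`-ball around `ρ` into the one around `(id ⊗ E)(ρ)`, and
does not decrease the min-entropy. -/
theorem IsTPCPM.smoothMinEntropy_le [Fintype A] [DecidableEq A] [DecidableEq B] [DecidableEq D]
    (hE : IsTPCPM E) (ε : ℝ) (ρ : Matrix (A × B) (A × B) ℂ) :
    smoothMinEntropy ε ρ ≤ smoothMinEntropy ε (idTensor E ρ) := by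
  refine iSup₂_le fun ρ' hρ' => ?_
  obtain ⟨⟨h₀, h₁, h₂⟩, hd⟩ := hρ'
  have htr := trace_idTensor (R := A) hE.2
  refine le_iSup₂_of_le (idTensor E ρ') ⟨⟨hE.posSemidef_idTensor h₀, ?_, ?_⟩, ?_⟩
    (hE.minEntropy_le ρ')
  · rwa [htr]
  · rwa [htr]
  · exact (hE.isTwoPositive_idTensor.purifiedDistance_le htr ρ' ρ).trans hd

end IdTensor

/-! ### Kraus operators -/

section Kraus

variable {κ R B C D : Type*} [Fintype κ] [Fintype B]

/-- The map `X ↦ ∑ k, V k X (V k)†` with Kraus operators `V k`. -/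
def krausMap (V : κ → Matrix D B ℂ) : Matrix B B ℂ →ₗ[ℂ] Matrix D D ℂ where
  toFun X := ∑ k, V k * X * (V k)ᴴ
  map_add' X Y := by simp [Matrix.mul_add, Matrix.add_mul, Finset.sum_add_distrib]
  map_smul' c X := by simp [Finset.smul_sum]

theorem krausMap_apply_apply (V : κ → Matrix D B ℂ) (X : Matrix B B ℂ) (d d' : D) :
    krausMap V X d d' = ∑ k, ∑ b, ∑ b', V k d b * X b b' * star (V k d' b') := by
  simp only [krausMap, LinearMap.coe_mk, AddHom.coe_mk, Matrix.sum_apply, Matrix.mul_apply,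
    conjTranspose_apply, Finset.sum_mul]
  exact Finset.sum_congr rfl fun k _ => Finset.sum_comm

theorem one_kronecker_conj_apply [Fintype R] [DecidableEq R]
    (V : Matrix D B ℂ) (X : Matrix (R × B) (R × B) ℂ) (p q : R × D) :
    (((1 : Matrix R R ℂ) ⊗ₖ V) * X * ((1 : Matrix R R ℂ) ⊗ₖ V)ᴴ) p q
      = ∑ b, ∑ b', V p.2 b * X (p.1, b) (q.1, b') * star (V q.2 b') := by
  rw [Matrix.mul_apply]
  simp only [Matrix.mul_apply, conjTranspose_apply, kroneckerMap_apply,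
    Fintype.sum_prod_type, one_apply, ite_mul, one_mul, zero_mul, Finset.sum_mul]
  rw [Finset.sum_eq_single q.1 (fun r _ hr => by simp [hr.symm]) (by simp)]
  simp only [if_true]
  rw [Finset.sum_comm, Finset.sum_eq_single p.1 (fun r _ hr => by simp [hr.symm]) (by simp)]
  rw [Finset.sum_comm]
  simp

theorem isTPCPM_krausMap [Fintype D] [DecidableEq B] (V : κ → Matrix D B ℂ)
    (hV : ∑ k, (V k)ᴴ * V k = 1) : IsTPCPM (krausMap V) := by
  refine ⟨fun n X hX => ?_, fun X => ?_⟩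
  · have h : idTensor (krausMap V) X
        = ∑ k, ((1 : Matrix (Fin n) (Fin n) ℂ) ⊗ₖ V k) * X * ((1 : Matrix _ _ ℂ) ⊗ₖ V k)ᴴ := by
      ext p q
      rw [idTensor, of_apply, krausMap_apply_apply, Matrix.sum_apply]
      exact Finset.sum_congr rfl fun k _ => (one_kronecker_conj_apply (V k) X p q).symm
    rw [h]
    exact posSemidef_sum _ fun k _ => hX.mul_mul_conjTranspose_same _
  · have h : ∀ k, (V k * X * (V k)ᴴ).trace = ((V k)ᴴ * V k * X).trace := fun k => by
      rw [Matrix.trace_mul_comm, Matrix.mul_assoc]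
    simp only [krausMap, LinearMap.coe_mk, AddHom.coe_mk, trace_sum, h]
    rw [← trace_sum, ← Matrix.sum_mul, hV, Matrix.one_mul]

/-- A TP-CPM has Kraus operators; they are read off from a factorization of its Choi matrix. -/
theorem IsTPCPM.exists_eq_krausMap [Fintype D] [DecidableEq B] [DecidableEq D]
    {E : Matrix B B ℂ →ₗ[ℂ] Matrix D D ℂ} (hE : IsTPCPM E) :
    ∃ V : B × D → Matrix D B ℂ, ∑ k, (V k)ᴴ * V k = 1 ∧ E = krausMap V := by
  set ω : B × B → ℂ := fun p => if p.1 = p.2 then 1 else 0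
  obtain ⟨G, hG⟩ := (hE.posSemidef_idTensor
    (posSemidef_vecMulVec_self_star ω)).exists_eq_conjTranspose_mul_self
  have hE_single : ∀ b b' d d', E (single b b' 1) d d'
      = ∑ k, star (G k (b, d)) * G k (b', d') := by
    intro b b' d d'
    have h := congrFun₂ hG (b, d) (b', d')
    rw [Matrix.mul_apply] at h
    simp only [conjTranspose_apply] at h
    have hs : (of fun x x' => vecMulVec ω (star ω) (b, x) (b', x')) = single b b' 1 := by
      ext x x'
      simp [ω, vecMulVec_apply, single_apply, ← ite_and, apply_ite star, and_comm]
    rw [← h, idTensor, of_apply, hs]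
  refine ⟨fun k => of fun d b => star (G k (b, d)), ?_, ?_⟩
  · ext b b'
    have h := hE.2 (single b' b 1)
    simp only [trace, diag_apply, hE_single] at h
    have h' : ∑ i, single b' b (1 : ℂ) i i = (1 : Matrix B B ℂ) b b' := by
      simp [single_apply, one_apply, ite_and]
    rw [← h', ← h, Finset.sum_comm, Matrix.sum_apply]
    refine Finset.sum_congr rfl fun k _ => ?_
    simp [Matrix.mul_apply, mul_comm]
  · refine Matrix.ext_linearMap ℂ fun b b' => LinearMap.ext_ring ?_
    ext d d'
    simp only [LinearMap.comp_apply, singleLinearMap_apply]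
    rw [krausMap_apply_apply, hE_single]
    simp [single_apply, ite_and]

end Kraus

/-! ### Purifications -/

section Purification

variable {κ I A B C C' D : Type*}

theorem traceOutMiddle_pure_apply [Fintype B] (ψ : (A × B) × C → ℂ) (p q : A × C) :
    traceOutMiddle (vecMulVec ψ (star ψ)) p q
      = ∑ b, ψ ((p.1, b), p.2) * star (ψ ((q.1, b), q.2)) := rfl

/-- A Kraus map acting on the purifying system may be applied to the pure state before the middle
system is traced out. -/
theorem idTensor_krausMap_traceOutMiddle [Fintype κ] [Fintype B] [Fintype C]
    (V : κ → Matrix C' C ℂ) (ψ : (A × B) × C → ℂ) (p q : A × C') :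
    idTensor (krausMap V) (traceOutMiddle (vecMulVec ψ (star ψ))) p q
      = ∑ k, ∑ b, (∑ c, V k p.2 c * ψ ((p.1, b), c)) * star (∑ c, V k q.2 c * ψ ((q.1, b), c)) := by
  rw [idTensor, of_apply, krausMap_apply_apply]
  refine Finset.sum_congr rfl fun k _ => ?_
  simp only [of_apply, traceOutMiddle_pure_apply, star_sum, star_mul', Finset.mul_sum,
    Finset.sum_mul]
  conv_rhs => rw [Finset.sum_comm]
  conv_lhs => rw [Finset.sum_comm]
  refine Finset.sum_congr rfl fun c _ => ?_
  rw [Finset.sum_comm]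
  exact Finset.sum_congr rfl fun b _ => Finset.sum_congr rfl fun c' _ => by ring

/-- The coefficient matrix of a purification has the transposed state as its Gram matrix. -/
theorem gram_of_isPurification [Fintype C] {ψ : I × C → ℂ} {ρ : Matrix I I ℂ}
    (h : traceOutRight (vecMulVec ψ (star ψ)) = ρ) :
    (of fun c i => ψ (i, c))ᴴ * (of fun c i => ψ (i, c)) = ρᵀ := by
  rw [← h]
  ext i j
  simp [traceOutRight, Matrix.mul_apply, vecMulVec_apply, mul_comm]

/-- Kraus operators that complete the contraction `K` to a trace preserving map: if
`1 - K† K = L† L`, the remaining ones are `x ↦ (L x)_i |c₀⟩` for a fixed basis vector `c₀`. -/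
def completion [DecidableEq C'] (K : Matrix C' C ℂ) (L : Matrix C C ℂ) (c₀ : C') :
    Option C → Matrix C' C ℂ
  | none => K
  | some i => of fun d c => if d = c₀ then L i c else 0

theorem sum_completion [Fintype C] [DecidableEq C] [Fintype C'] [DecidableEq C']
    {K : Matrix C' C ℂ} {L : Matrix C C ℂ} (h : 1 - Kᴴ * K = Lᴴ * L) (c₀ : C') :
    ∑ k, (completion K L c₀ k)ᴴ * completion K L c₀ k = 1 := by
  rw [Fintype.sum_option, ← sub_add_cancel 1 (Kᴴ * K), h, add_comm]
  congr 1
  ext c c'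
  simp [completion, Matrix.sum_apply, Matrix.mul_apply, apply_ite star]

/-- Two purifications of a state are related by a TP-CPM on the purifying system, so that the
smooth min-entropies of the resulting marginals can be compared by data processing. -/
theorem smoothMinEntropy_traceOutMiddle_le [Fintype A] [DecidableEq A] [Fintype B]
    [Fintype C] [DecidableEq C] [Fintype C'] [DecidableEq C'] (ε : ℝ)
    {ρ : Matrix (A × B) (A × B) ℂ} (hρ : ρ ≠ 0)
    {Φ : Matrix ((A × B) × C) ((A × B) × C) ℂ} {Φ' : Matrix ((A × B) × C') ((A × B) × C') ℂ}
    (hΦ : IsPurification Φ ρ) (hΦ' : IsPurification Φ' ρ) :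
    smoothMinEntropy ε (traceOutMiddle Φ) ≤ smoothMinEntropy ε (traceOutMiddle Φ') := by
  classical
  obtain ⟨⟨ψ, rfl⟩, hψ⟩ := hΦ
  obtain ⟨⟨ψ', rfl⟩, hψ'⟩ := hΦ'
  -- the purifying system of a nonzero state is nontrivial
  obtain ⟨c₀⟩ : Nonempty C' := by
    by_contra hC
    rw [not_nonempty_iff] at hC
    exact hρ (by rw [← hψ']; ext; simp [traceOutRight])
  set M : Matrix C (A × B) ℂ := of fun c i => ψ (i, c)
  set N : Matrix C' (A × B) ℂ := of fun c i => ψ' (i, c)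
  have hM : Mᴴ * M = Nᴴ * N :=
    (gram_of_isPurification hψ).trans (gram_of_isPurification hψ').symm
  obtain ⟨K, hK, hN⟩ := exists_contraction_mul M N hM
  obtain ⟨L, hL⟩ := PosSemidef.exists_eq_conjTranspose_mul_self hK
  -- the added Kraus operators annihilate the pure state
  have hLM : L * M = 0 := by
    refine conjTranspose_mul_self_eq_zero.1 ?_
    calc (L * M)ᴴ * (L * M) = Mᴴ * (Lᴴ * L) * M := by
          simp only [conjTranspose_mul, Matrix.mul_assoc]
      _ = Mᴴ * M - (K * M)ᴴ * (K * M) := by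
          rw [← hL]
          simp only [conjTranspose_mul, Matrix.mul_sub, Matrix.sub_mul, Matrix.mul_one,
            Matrix.mul_assoc]
      _ = 0 := by rw [← hN, hM, sub_self]
  have h := (isTPCPM_krausMap _ (sum_completion hL c₀)).smoothMinEntropy_le ε
    (traceOutMiddle (vecMulVec ψ (star ψ)))
  convert h using 2
  have hN' : ∀ i c', ∑ c, K c' c * ψ (i, c) = ψ' (i, c') := fun i c' =>
    (congrFun₂ hN c' i).symm
  have hL' : ∀ i j, ∑ c, L j c * ψ (i, c) = 0 := fun i j => congrFun₂ hLM j i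
  ext p q
  rw [idTensor_krausMap_traceOutMiddle, Fintype.sum_option, traceOutMiddle_pure_apply]
  simp [completion, hN', hL', ite_mul, Finset.sum_ite_irrel]

/-- If `E` has Kraus operators `V k` and `ψ` purifies `ρ`, the vector `∑ k, V k ψ ⊗ |k⟩` purifies
`(id ⊗ E)(ρ)`: this is the image of `ψ` under the Stinespring isometry of `E`. -/
def stinespringVector [Fintype B] (V : κ → Matrix D B ℂ) (ψ : (A × B) × C → ℂ) :
    (A × D) × (κ × C) → ℂ :=
  fun p => ∑ b, V p.2.1 p.1.2 b * ψ ((p.1.1, b), p.2.2)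

theorem traceOutRight_stinespringVector [Fintype κ] [Fintype B] [Fintype C]
    (V : κ → Matrix D B ℂ) (ψ : (A × B) × C → ℂ) :
    traceOutRight (vecMulVec (stinespringVector V ψ) (star (stinespringVector V ψ)))
      = idTensor (krausMap V) (traceOutRight (vecMulVec ψ (star ψ))) := by
  ext p q
  rw [idTensor, of_apply, krausMap_apply_apply]
  simp only [traceOutRight, of_apply, vecMulVec_apply, Pi.star_apply, Fintype.sum_prod_type,
    stinespringVector, star_sum, star_mul', Finset.mul_sum, Finset.sum_mul]
  refine Finset.sum_congr rfl fun k _ => ?_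
  conv_rhs => rw [Finset.sum_comm]
  rw [Finset.sum_comm]
  refine Finset.sum_congr rfl fun b _ => ?_
  rw [Finset.sum_comm]
  exact Finset.sum_congr rfl fun b' _ => Finset.sum_congr rfl fun c _ => by ring

/-- Kraus operators of the partial trace over the first tensor factor. -/
def partialTraceKraus (κ C : Type*) [DecidableEq κ] [DecidableEq C] (k : κ) :
    Matrix C (κ × C) ℂ :=
  of fun c p => if (k, c) = p then 1 else 0

theorem sum_partialTraceKraus [Fintype κ] [DecidableEq κ] [Fintype C] [DecidableEq C] :
    ∑ k, (partialTraceKraus κ C k)ᴴ * partialTraceKraus κ C k = 1 := by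
  ext p q
  simp only [Matrix.sum_apply, Matrix.mul_apply, partialTraceKraus, conjTranspose_apply, of_apply]
  rw [← Fintype.sum_prod_type (f := fun x : κ × C =>
    star (if x = p then (1 : ℂ) else 0) * if x = q then 1 else 0)]
  simp [one_apply, apply_ite star, eq_comm]

/-- Tracing out the environment of the Stinespring isometry, and the output of the channel, is the
same as tracing out its input. -/
theorem idTensor_partialTrace_stinespringVector [Fintype κ] [DecidableEq κ] [Fintype B]
    [DecidableEq B] [Fintype C] [DecidableEq C] [Fintype D] {V : κ → Matrix D B ℂ}
    (hV : ∑ k, (V k)ᴴ * V k = 1) (ψ : (A × B) × C → ℂ) :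
    idTensor (krausMap (partialTraceKraus κ C)) (traceOutMiddle
        (vecMulVec (stinespringVector V ψ) (star (stinespringVector V ψ))))
      = traceOutMiddle (vecMulVec ψ (star ψ)) := by
  have hV' : ∀ b b', ∑ k, ∑ d, V k d b * star (V k d b') = if b = b' then 1 else 0 := by
    intro b b'
    have h := congrFun₂ hV b' b
    simp only [Matrix.sum_apply, Matrix.mul_apply, conjTranspose_apply, one_apply] at h
    simp only [eq_comm (a := b), ← h, mul_comm]
  ext p q
  rw [idTensor_krausMap_traceOutMiddle, traceOutMiddle_pure_apply]
  simp only [partialTraceKraus, of_apply, ite_mul, one_mul, zero_mul, Finset.sum_ite_eq,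
    Finset.mem_univ, if_true, stinespringVector, star_sum, star_mul', Finset.sum_mul_sum]
  calc _ = ∑ b, ∑ b', (∑ k, ∑ d, V k d b * star (V k d b'))
        * (ψ ((p.1, b), p.2) * star (ψ ((q.1, b'), q.2))) := by
        simp only [Finset.sum_mul]
        refine Eq.symm ((Finset.sum_congr rfl fun b _ => Finset.sum_comm.trans
          (Finset.sum_congr rfl fun k _ => Finset.sum_comm)).trans
          (Finset.sum_comm.trans (Finset.sum_congr rfl fun k _ => Finset.sum_comm.trans ?_)))
        exact Finset.sum_congr rfl fun d _ => Finset.sum_congr rfl fun b _ =>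
          Finset.sum_congr rfl fun b' _ => by ring
    _ = _ := by simp only [hV', ite_mul, one_mul, zero_mul, Finset.sum_ite_eq, Finset.mem_univ,
        if_true]

/-- Data processing for the smooth max-entropy: by duality it becomes data processing for the
partial trace over the environment of a Stinespring dilation of `E`. -/
theorem IsTPCPM.smoothMaxEntropy_le [Fintype A] [DecidableEq A] [Fintype B] [DecidableEq B]
    [Fintype D] [DecidableEq D] {E : Matrix B B ℂ →ₗ[ℂ] Matrix D D ℂ} (hE : IsTPCPM E) (ε : ℝ)
    {ρ : Matrix (A × B) (A × B) ℂ} (hρ : ρ.PosSemidef) (hτ : idTensor E ρ ≠ 0) :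
    smoothMaxEntropy ε ρ ≤ smoothMaxEntropy ε (idTensor E ρ) := by
  obtain ⟨V, hV, rfl⟩ := hE.exists_eq_krausMap
  set ψ : (A × B) × (A × B) → ℂ := fun p => CFC.sqrt ρ p.1 p.2
  have hψ : canonicalPurification ρ = vecMulVec ψ (star ψ) := rfl
  have hΨ : IsPurification (vecMulVec (stinespringVector V ψ) (star (stinespringVector V ψ)))
      (idTensor (krausMap V) ρ) := by
    refine ⟨⟨_, rfl⟩, ?_⟩
    rw [traceOutRight_stinespringVector, ← hψ, (isPurification_canonicalPurification hρ).2]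
  have htr := isTPCPM_krausMap _ (sum_partialTraceKraus (κ := B × D) (C := A × B))
  have h := htr.smoothMinEntropy_le ε
    (traceOutMiddle (vecMulVec (stinespringVector V ψ) (star (stinespringVector V ψ))))
  rw [idTensor_partialTrace_stinespringVector hV, ← hψ] at h
  exact EReal.neg_le_neg_iff.2 ((smoothMinEntropy_traceOutMiddle_le ε hτ
    (isPurification_canonicalPurification (hE.posSemidef_idTensor hρ)) hΨ).trans h)

/-- The smooth max-entropy may be computed from any purification. -/
theorem smoothMaxEntropy_eq_of_isPurification [Fintype A] [DecidableEq A] [Fintype B]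
    [DecidableEq B] [Fintype C] [DecidableEq C] (ε : ℝ) {ρ : Matrix (A × B) (A × B) ℂ}
    (hρ : ρ.PosSemidef) (hρ₀ : ρ ≠ 0) {Φ : Matrix ((A × B) × C) ((A × B) × C) ℂ}
    (hΦ : IsPurification Φ ρ) :
    smoothMaxEntropy ε ρ = -smoothMinEntropy ε (traceOutMiddle Φ) := by
  have hcan := isPurification_canonicalPurification hρ
  exact congrArg _ (le_antisymm (smoothMinEntropy_traceOutMiddle_le ε hρ₀ hcan hΦ)
    (smoothMinEntropy_traceOutMiddle_le ε hρ₀ hΦ hcan))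

end Purification

end QInfo

theorem theorem1 {A B D : Type*}
    [Fintype A] [DecidableEq A] [Fintype B] [DecidableEq B] [Fintype D] [DecidableEq D]
    (ε : ℝ) (hε : 0 ≤ ε)
    (ρ : Matrix (A × B) (A × B) ℂ) (hρ : QInfo.IsSubnormalizedState ρ)
    (hερ : ε < Real.sqrt ρ.trace.re)
    (E : Matrix B B ℂ →ₗ[ℂ] Matrix D D ℂ) (hE : QInfo.IsTPCPM E)
    (τ : Matrix (A × D) (A × D) ℂ) (hτ : τ = QInfo.idTensor E ρ) :
    QInfo.smoothMinEntropy ε ρ ≤ QInfo.smoothMinEntropy ε τ ∧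
    QInfo.smoothMaxEntropy ε ρ ≤ QInfo.smoothMaxEntropy ε τ ∧
    -- the smooth max-entropies of `ρ` and `τ` may be computed from arbitrary purifications
    (∀ {C : Type*} [Fintype C] [DecidableEq C] (Φ : Matrix ((A × B) × C) ((A × B) × C) ℂ),
      QInfo.IsPurification Φ ρ →
      QInfo.smoothMaxEntropy ε ρ = -QInfo.smoothMinEntropy ε (QInfo.traceOutMiddle Φ)) ∧
    (∀ {C : Type*} [Fintype C] [DecidableEq C] (Φ : Matrix ((A × D) × C) ((A × D) × C) ℂ),
      QInfo.IsPurification Φ τ →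
      QInfo.smoothMaxEntropy ε τ = -QInfo.smoothMinEntropy ε (QInfo.traceOutMiddle Φ)) := by
  subst hτ
  have hρ₀ : ρ ≠ 0 := by
    rintro rfl
    simpa using hρ.2.1
  have hτ₀ : QInfo.idTensor E ρ ≠ 0 := by
    intro h
    have h' := hρ.2.1
    rw [← QInfo.trace_idTensor hE.2, h] at h'
    simp at h'
  exact ⟨hE.smoothMinEntropy_le ε ρ, hE.smoothMaxEntropy_le ε hρ.1 hτ₀,
    fun Φ hΦ => QInfo.smoothMaxEntropy_eq_of_isPurification ε hρ.1 hρ₀ hΦ,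
    fun Φ hΦ => QInfo.smoothMaxEntropy_eq_of_isPurification ε (hE.posSemidef_idTensor hρ.1)
      hτ₀ hΦ⟩
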